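/- All manifolds, metrics and vector fields are $C^\infty$. Let $n\ge 2$ and $k\ge 0$, let $(N,g)$ be a Riemannian manifold of dimension $n+k$ with Levi-Civita connection $\nabla$, let $M\subset N$ be a submanifold of dimension $n$ and $L\subset M$ a submanifold of dimension $n-1$ (embedded or injectively immersed), both with the induced metrics. Assume that $L$ is not totally geodesic in $N$ at any point, i.e. for every $x\in L$ there is a geodesic $\gamma$ of $L$ through $x$ with $\nabla_{\dot\gamma}\dot\gamma|_x\neq 0$. Let $Y:M\to TN$, $Y(x)\in T_xN$, be a vector field along $M$ that is parallel along $M$, i.e. $\nabla_WY=0$ for every $W\in TM$, and that is orthogonal to $L$, i.e. $Y(x)\perp T_xL$ for every $x\in L$. Put $$S\partial(M,Y)=\{x\in M \mid Y(x)\in T_xM\}.$$ Call $L$ totally geodesic in $M$ if every geodesic of $L$ is a geodesic of $M$. (a) If $Y$ has no zero on $L$ and $L\subset S\partial(M,Y)$, then $L$ is totally geodesic in $M$. (b) If $k\le 1$ and $L$ is totally geodesic in $M$, then $L\subset S\partial(M,Y)$. In particular, if $k\le 1$ and $Y$ has no zero on $L$, then $L\subset S\partial(M,Y)$ if and only if $L$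 is totally geodesic in $M$. -/

import Mathlib

open Bundle
open scoped Manifold ContDiff

set_option linter.unusedSectionVars false

noncomputable section

section LeviCivita

variable {E : Type*} [NormedAddCommGroup E] [NormedSpace ℝ E] [FiniteDimensional ℝ E]
  {H : Type*} [TopologicalSpace H] (I : ModelWithCorners ℝ E H)
  {N : Type*} [TopologicalSpace N] [ChartedSpace H N] [IsManifold I ∞ N]
  [RiemannianBundle (fun p : N => TangentSpace I p)]

instance tangentSpaceFiniteDimensional (p : N) : FiniteDimensional ℝ (TangentSpace I p) :=
  inferInstanceAs (FiniteDimensional ℝ E)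

/-- The vector field with constant coefficients in the preferred chart at `p` whose value at `p`
is `a`. It is the linear combination of the coordinate fields `∂ᵢ` of that chart with the
coefficients of `a`; such fields commute with each other on the domain of the chart. -/
def coordField {p : N} (a : TangentSpace I p) (q : N) : TangentSpace I q :=
  (trivializationAt E (fun r : N => TangentSpace I r) p).symmL ℝ q
    (trivializationAt E (fun r : N => TangentSpace I r) p ⟨p, a⟩).2

/-- The derivative at `p`, in the direction `a`, of the metric coefficient
`q ↦ g_q(B, C)`, where `B`, `C` have constant coefficients in the preferred chart at `p`
and `B p = b`, `C p = c`. On coordinate vectors this is `∂ₐ g_{bc}` at `p`. -/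
def metricDeriv {p : N} (a b c : TangentSpace I p) : ℝ :=
  mvfderiv I (fun q : N => (inner ℝ (coordField I b q) (coordField I c q) : ℝ)) p a

/-- Christoffel symbol of the first kind at `p`, in the preferred chart at `p`:
`½ (∂ₐ g_{bc} + ∂_b g_{ac} - ∂_c g_{ab})`. -/
def christoffelFirst {p : N} (a b c : TangentSpace I p) : ℝ :=
  (metricDeriv I a b c + metricDeriv I b a c - metricDeriv I c a b) / 2

/-- Christoffel symbol (of the second kind) at `p`, in the preferred chart at `p`: the vector
`Γ(a, b) = ∇_A B (p)`, with `∇` the Levi-Civita connection and `A`, `B` the fields with constant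
coefficients through `a`, `b`. It is the vector with `g(Γ(a, b), c) = christoffelFirst a b c` for
all `c` (see `inner_christoffel`), written in a `g_p`-orthonormal basis. -/
def christoffel {p : N} (a b : TangentSpace I p) : TangentSpace I p :=
  ∑ l, christoffelFirst I a b (stdOrthonormalBasis ℝ (TangentSpace I p) l) •
    stdOrthonormalBasis ℝ (TangentSpace I p) l

section Lemmas

variable [IsContMDiffRiemannianBundle I ∞ E (fun p : N => TangentSpace I p)]

theorem mdiff_coordField {p : N} (b : TangentSpace I p) :
    MDifferentiableAt I I.tangent (fun q : N => (⟨q, coordField I b q⟩ : TangentBundle I N)) p := by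
  refine (FiberBundle.mdifferentiableAt_extend I E b).congr_of_eventuallyEq ?_
  set t := trivializationAt E (fun r : N => TangentSpace I r) p with ht
  filter_upwards [t.open_baseSet.mem_nhds (FiberBundle.mem_baseSet_trivializationAt' p)] with q hq
  simp only [coordField, FiberBundle.extend]
  congr 1
  rw [Trivialization.symmL_apply _ hq]

theorem mdiff_inner_coordField {p : N} (b c : TangentSpace I p) :
    MDifferentiableAt I 𝓘(ℝ, ℝ)
      (fun q : N => (inner ℝ (coordField I b q) (coordField I c q) : ℝ)) p :=
  MDifferentiableAt.inner_bundle (F := E) (E := fun p : N => TangentSpace I p)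
    (mdiff_coordField I b) (mdiff_coordField I c)

theorem coordField_add {p : N} (a b : TangentSpace I p) (q : N) :
    coordField I (a + b) q = coordField I a q + coordField I b q := by
  unfold coordField
  set t := trivializationAt E (fun r : N => TangentSpace I r) p
  have hp : p ∈ t.baseSet := FiberBundle.mem_baseSet_trivializationAt' p
  rw [(t.linear ℝ hp).map_add, map_add]

theorem coordField_smul {p : N} (r : ℝ) (a : TangentSpace I p) (q : N) :
    coordField I (r • a) q = r • coordField I a q := by
  unfold coordField
  set t := trivializationAt E (fun r : N => TangentSpace I r) p
  have hp : p ∈ t.baseSet := FiberBundle.mem_baseSet_trivializationAt' p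
  rw [(t.linear ℝ hp).map_smul, map_smul]

theorem metricDeriv_comm {p : N} (a b c : TangentSpace I p) :
    metricDeriv I a b c = metricDeriv I a c b := by
  unfold metricDeriv
  have : (fun q : N => (inner ℝ (coordField I b q) (coordField I c q) : ℝ)) =
    fun q : N => (inner ℝ (coordField I c q) (coordField I b q) : ℝ) :=
    funext fun q => real_inner_comm _ _
  rw [this]

theorem metricDeriv_add_right {p : N} (a b c c' : TangentSpace I p) :
    metricDeriv I a b (c + c') = metricDeriv I a b c + metricDeriv I a b c' := by
  unfold metricDeriv
  simp only [coordField_add, inner_add_right]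
  have := mvfderiv_add (mdiff_inner_coordField I b c) (mdiff_inner_coordField I b c')
  exact congr($this a)

theorem metricDeriv_smul_right {p : N} (r : ℝ) (a b c : TangentSpace I p) :
    metricDeriv I a b (r • c) = r * metricDeriv I a b c := by
  unfold metricDeriv
  simp only [coordField_smul, inner_smul_right]
  have := const_smul_mfderiv (mdiff_inner_coordField I b c) r
  exact congr($this a)

theorem metricDeriv_linear {p : N} (a a' b c : TangentSpace I p) (r : ℝ) :
    metricDeriv I (a + r • a') b c = metricDeriv I a b c + r * metricDeriv I a' b c := by
  unfold metricDeriv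
  rw [map_add, map_smul]; rfl

/-- `christoffelFirst` as a linear form in its last argument. -/
def christoffelFirstLM {p : N} (a b : TangentSpace I p) : TangentSpace I p →ₗ[ℝ] ℝ where
  toFun c := christoffelFirst I a b c
  map_add' c c' := by
    have := metricDeriv_linear I c c' a b 1
    simp only [one_smul, one_mul] at this
    simp only [christoffelFirst, metricDeriv_add_right, this]; ring
  map_smul' r c := by
    have h0 : metricDeriv I (r • c) a b = r * metricDeriv I c a b := by
      unfold metricDeriv; rw [map_smul]; rfl
    simp only [christoffelFirst, metricDeriv_smul_right, h0, smul_eq_mul, RingHom.id_apply]; ring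

/-- The defining property of the Christoffel symbol. -/
theorem inner_christoffel {p : N} (a b c : TangentSpace I p) :
    inner ℝ (christoffel I a b) c = christoffelFirst I a b c := by
  have h := congrArg (christoffelFirstLM I a b)
    ((stdOrthonormalBasis ℝ (TangentSpace I p)).sum_repr' c)
  rw [map_sum] at h
  simp only [map_smul, smul_eq_mul] at h
  rw [christoffel, sum_inner]
  simp only [real_inner_smul_left]
  refine Eq.trans (Finset.sum_congr rfl fun l _ => ?_) h
  rw [mul_comm]; rfl

/-- The connection is torsion-free. -/
theorem christoffel_comm {p : N} (a b : TangentSpace I p) : christoffel I a b = christoffel I b a := by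
  refine ext_inner_right ℝ fun c => ?_
  simp only [inner_christoffel, christoffelFirst, metricDeriv_comm I c a b]; ring

/-- The connection is compatible with the metric. -/
theorem metricDeriv_eq {p : N} (a b c : TangentSpace I p) :
    metricDeriv I a b c = inner ℝ (christoffel I a b) c + inner ℝ b (christoffel I a c) := by
  rw [real_inner_comm _ b]
  simp only [inner_christoffel, christoffelFirst, metricDeriv_comm I a c b, metricDeriv_comm I b a c,
    metricDeriv_comm I c a b]
  ring

end Lemmas

variable {E' : Type*} [NormedAddCommGroup E'] [NormedSpace ℝ E']
  {H' : Type*} [TopologicalSpace H'] (I' : ModelWithCorners ℝ E' H')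
  {M : Type*} [TopologicalSpace M] [ChartedSpace H' M]

/-- The covariant derivative `∇_W Y (x)` of a vector field `Y : M → TN` along a map `f : M → N`,
in the direction `W ∈ T_x M`, for the Levi-Civita connection of `N`: in the preferred chart of
`N` at `f x` it is `d(Y¹, …, Yᵈ)_x (W) + Γ(df_x W, Y x)`. -/
def covDerivAlong (f : M → N) (Y : ∀ y : M, TangentSpace I (f y)) (x : M)
    (W : TangentSpace I' x) : TangentSpace I (f x) :=
  (trivializationAt E (fun q : N => TangentSpace I q) (f x)).symmL ℝ (f x)
    (mvfderiv I'
      (fun y : M => (trivializationAt E (fun q : N => TangentSpace I q) (f x) ⟨f y, Y y⟩).2) x W)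
  + christoffel I (mfderiv I' I f x W) (Y x)

/-- The velocity vector `γ'(t)` of a curve. -/
def velocity (γ : ℝ → N) (t : ℝ) : TangentSpace I (γ t) :=
  mfderiv 𝓘(ℝ, ℝ) I γ t (1 : ℝ)

/-- The acceleration `∇_{γ'} γ' (t)` of a curve. -/
def acceleration (γ : ℝ → N) (t : ℝ) : TangentSpace I (γ t) :=
  covDerivAlong I 𝓘(ℝ, ℝ) γ (velocity I γ) t (1 : ℝ)

/-- `γ` restricted to `s` is a geodesic of `N`: `s` is an open interval, `γ` is smooth on `s` and
`∇_{γ'} γ' = 0` on `s`. -/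
structure IsGeodesicOn (γ : ℝ → N) (s : Set ℝ) : Prop where
  isOpen : IsOpen s
  ordConnected : s.OrdConnected
  contMDiffOn : ContMDiffOn 𝓘(ℝ, ℝ) I ∞ γ s
  acceleration_eq_zero : ∀ t ∈ s, acceleration I γ t = 0

/-- A vector field along `f : M → N` is parallel along `M`: it is smooth and `∇_W Y = 0` for every
`W ∈ TM`. -/
structure IsParallelAlong (f : M → N) (Y : ∀ y : M, TangentSpace I (f y)) : Prop where
  contMDiff : ContMDiff I' I.tangent ∞ (fun y : M => (⟨f y, Y y⟩ : TangentBundle I N))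
  covDerivAlong_eq_zero : ∀ (x : M) (W : TangentSpace I' x), covDerivAlong I I' f Y x W = 0

/-- The shadow boundary `S∂(M, Y)` of a submanifold `f : M → N`: the points of `M` where `Y` is
tangent to `M`. -/
def shadowBoundary (f : M → N) (Y : ∀ y : M, TangentSpace I (f y)) : Set M :=
  {x | ∃ w : TangentSpace I' x, mfderiv I' I f x w = Y x}

end LeviCivita

section Submanifolds

variable {E : Type*} [NormedAddCommGroup E] [NormedSpace ℝ E] [FiniteDimensional ℝ E]
  {H : Type*} [TopologicalSpace H] (I : ModelWithCorners ℝ E H)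
  {N : Type*} [TopologicalSpace N] [ChartedSpace H N] [IsManifold I ∞ N]
  [RiemannianBundle (fun p : N => TangentSpace I p)]
  {E' : Type*} [NormedAddCommGroup E'] [NormedSpace ℝ E'] [FiniteDimensional ℝ E']
  {H' : Type*} [TopologicalSpace H'] (I' : ModelWithCorners ℝ E' H')
  {M : Type*} [TopologicalSpace M] [ChartedSpace H' M] [IsManifold I' ∞ M]
  [RiemannianBundle (fun p : M => TangentSpace I' p)]

/-- `f : M → N` is (the inclusion of) a Riemannian submanifold, embedded or just immersed: it is
injective and smooth, and the metric of `M` is the one induced from `N`. The last condition makes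
the differentials of `f` injective, so that `f` is an immersion. -/
structure IsRiemannianSubmanifold (f : M → N) : Prop where
  contMDiff : ContMDiff I' I ∞ f
  injective : Function.Injective f
  isometric : ∀ (x : M) (v w : TangentSpace I' x),
    inner ℝ (mfderiv I' I f x v) (mfderiv I' I f x w) = inner ℝ v w

/-- `M` is a totally geodesic submanifold of `N`: every geodesic of `M` is a geodesic of `N`. -/
def IsTotallyGeodesic (f : M → N) : Prop :=
  ∀ (γ : ℝ → M) (s : Set ℝ), IsGeodesicOn I' γ s → IsGeodesicOn I (f ∘ γ) s

/-- `M` is a totally geodesic submanifold of `N` at the point `x`: every geodesic of `M` through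
`x` has vanishing acceleration in `N` at `x`. -/
def IsTotallyGeodesicAt (f : M → N) (x : M) : Prop :=
  ∀ (γ : ℝ → M) (s : Set ℝ), IsGeodesicOn I' γ s → ∀ t ∈ s, γ t = x →
    acceleration I (f ∘ γ) t = 0

end Submanifolds

end

noncomputable section

section CovariantDerivative

variable {E : Type*} [NormedAddCommGroup E] [NormedSpace ℝ E] [FiniteDimensional ℝ E]
  {H : Type*} [TopologicalSpace H] (I : ModelWithCorners ℝ E H)
  {N : Type*} [TopologicalSpace N] [ChartedSpace H N] [IsManifold I ∞ N]
  {E' : Type*} [NormedAddCommGroup E'] [NormedSpace ℝ E']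
  {H' : Type*} [TopologicalSpace H'] (I' : ModelWithCorners ℝ E' H')
  {M : Type*} [TopologicalSpace M] [ChartedSpace H' M]

theorem mvfderiv_congr_of_eventuallyEq {F : Type*} [NormedAddCommGroup F] [NormedSpace ℝ F]
    {f g : M → F} {x : M} (h : f =ᶠ[nhds x] g) (W : TangentSpace I' x) :
    mvfderiv I' f x W = mvfderiv I' g x W :=
  congr($(h.mfderiv_eq (I := I') (I' := 𝓘(ℝ, F))) W)

theorem mvfderiv_sum_apply {ι : Type*} (s : Finset ι) {f : ι → M → ℝ} {x : M}
    (hf : ∀ i ∈ s, MDifferentiableAt I' 𝓘(ℝ, ℝ) (f i) x) (W : TangentSpace I' x) :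
    MDifferentiableAt I' 𝓘(ℝ, ℝ) (fun y => ∑ i ∈ s, f i y) x ∧
      mvfderiv I' (fun y => ∑ i ∈ s, f i y) x W = ∑ i ∈ s, mvfderiv I' (f i) x W := by
  classical
  induction s using Finset.induction_on with
  | empty =>
    simp only [Finset.sum_empty]
    exact ⟨mdifferentiableAt_const, by rw [mvfderiv_const]; rfl⟩
  | insert a s ha ih =>
    obtain ⟨h1, h2⟩ := ih fun i hi => hf i (Finset.mem_insert_of_mem hi)
    have h0 := hf a (Finset.mem_insert_self a s)
    simp only [Finset.sum_insert ha]
    refine ⟨h0.add h1, ?_⟩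
    rw [← h2]
    exact congr($(mvfderiv_fun_add h0 h1) W)

variable {I I'} in
theorem mdifferentiableAt_base {f : M → N} {Y : ∀ y : M, TangentSpace I (f y)} {x : M}
    (hY : MDifferentiableAt I' I.tangent (fun y : M => (⟨f y, Y y⟩ : TangentBundle I N)) x) :
    MDifferentiableAt I' I f x :=
  ((mdifferentiableAt_totalSpace _ _).1 hY).1

variable {I I'} in
theorem mdifferentiableAt_coord {f : M → N} {Y : ∀ y : M, TangentSpace I (f y)} {x : M}
    (hY : MDifferentiableAt I' I.tangent (fun y : M => (⟨f y, Y y⟩ : TangentBundle I N)) x) :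
    MDifferentiableAt I' 𝓘(ℝ, E)
      (fun y : M => (trivializationAt E (fun q : N => TangentSpace I q) (f x) ⟨f y, Y y⟩).2) x :=
  ((mdifferentiableAt_totalSpace _ _).1 hY).2

theorem coordField_self {p : N} (a : TangentSpace I p) : coordField I a p = a := by
  have hp : p ∈ (trivializationAt E (fun r : N => TangentSpace I r) p).baseSet :=
    FiberBundle.mem_baseSet_trivializationAt' p
  rw [coordField, Trivialization.symmL_apply _ hp]
  exact Trivialization.symm_apply_apply_mk _ hp a

/-- The coordinates of a tangent vector at `q` in the preferred chart at `p`, viewed as a tangent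
vector at `p`. -/
def transportTo (p : N) {q : N} (v : TangentSpace I q) : TangentSpace I p :=
  (trivializationAt E (fun r : N => TangentSpace I r) p).symmL ℝ p
    (trivializationAt E (fun r : N => TangentSpace I r) p ⟨q, v⟩).2

theorem transportTo_self {p : N} (v : TangentSpace I p) : transportTo I p v = v :=
  coordField_self I v

theorem coordField_transportTo {p q : N}
    (hq : q ∈ (trivializationAt E (fun r : N => TangentSpace I r) p).baseSet)
    (v : TangentSpace I q) : coordField I (transportTo I p v) q = v := by
  have hp : p ∈ (trivializationAt E (fun r : N => TangentSpace I r) p).baseSet :=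
    FiberBundle.mem_baseSet_trivializationAt' p
  rw [coordField, transportTo, Trivialization.symmL_apply _ hp, Trivialization.symmL_apply _ hq,
    Trivialization.apply_mk_symm _ hp]
  exact Trivialization.symm_apply_apply_mk _ hq v

variable [RiemannianBundle (fun p : N => TangentSpace I p)]
  [IsContMDiffRiemannianBundle I ∞ E (fun p : N => TangentSpace I p)]

theorem coordField_sum {ι : Type*} (s : Finset ι) {p : N} (r : ι → ℝ) (a : ι → TangentSpace I p)
    (q : N) : coordField I (∑ l ∈ s, r l • a l) q = ∑ l ∈ s, r l • coordField I (a l) q := by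
  let T : TangentSpace I p →ₗ[ℝ] TangentSpace I q :=
    { toFun := fun a => coordField I a q
      map_add' := fun a b => coordField_add I a b q
      map_smul' := fun r a => coordField_smul I r a q }
  exact (map_sum T (fun l => r l • a l) s).trans
    (Finset.sum_congr rfl fun l _ => T.map_smul (r l) (a l))

theorem metricDeriv_sum_right {ι : Type*} (s : Finset ι) {p : N} (a b : TangentSpace I p)
    (r : ι → ℝ) (c : ι → TangentSpace I p) :
    metricDeriv I a b (∑ l ∈ s, r l • c l) = ∑ l ∈ s, r l * metricDeriv I a b (c l) := by
  let T : TangentSpace I p →ₗ[ℝ] ℝ :=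
    { toFun := fun c => metricDeriv I a b c
      map_add' := metricDeriv_add_right I a b
      map_smul' := fun r c => metricDeriv_smul_right I r a b c }
  exact (map_sum T (fun l => r l • c l) s).trans
    (Finset.sum_congr rfl fun l _ => T.map_smul (r l) (c l))

theorem metricDeriv_sum_sum {ι : Type*} (s : Finset ι) {p : N} (a : TangentSpace I p)
    (r r' : ι → ℝ) (c : ι → TangentSpace I p) :
    metricDeriv I a (∑ l ∈ s, r l • c l) (∑ m ∈ s, r' m • c m) =
      ∑ l ∈ s, ∑ m ∈ s, r l * r' m * metricDeriv I a (c l) (c m) := by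
  rw [metricDeriv_comm, metricDeriv_sum_right]
  refine Finset.sum_congr rfl fun l _ => ?_
  rw [metricDeriv_comm, metricDeriv_sum_right, Finset.mul_sum]
  exact Finset.sum_congr rfl fun m _ => by ring

theorem inner_sum_sum {V ι : Type*} [NormedAddCommGroup V] [InnerProductSpace ℝ V] (s : Finset ι)
    (r r' : ι → ℝ) (c : ι → V) :
    inner ℝ (∑ l ∈ s, r l • c l) (∑ m ∈ s, r' m • c m) =
      ∑ l ∈ s, ∑ m ∈ s, r l * r' m * inner ℝ (c l) (c m) := by
  rw [sum_inner]
  refine Finset.sum_congr rfl fun l _ => ?_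
  rw [inner_sum]
  refine Finset.sum_congr rfl fun m _ => ?_
  rw [real_inner_smul_left, real_inner_smul_right]
  ring

variable {I I'} {f : M → N} {Y Z : ∀ y : M, TangentSpace I (f y)} {x : M}

/-- The part of `covDerivAlong` that differentiates the components of the field. -/
def componentDeriv (f : M → N) (Y : ∀ y : M, TangentSpace I (f y)) (x : M)
    (W : TangentSpace I' x) : TangentSpace I (f x) :=
  (trivializationAt E (fun q : N => TangentSpace I q) (f x)).symmL ℝ (f x)
    (mvfderiv I'
      (fun y : M => (trivializationAt E (fun q : N => TangentSpace I q) (f x) ⟨f y, Y y⟩).2) x W)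

theorem covDerivAlong_eq (W : TangentSpace I' x) :
    covDerivAlong I I' f Y x W =
      componentDeriv f Y x W + christoffel I (mfderiv I' I f x W) (Y x) := rfl

theorem mdifferentiableAt_repr_transportTo {ι : Type*} (b : Module.Basis ι ℝ (TangentSpace I (f x)))
    (hY : MDifferentiableAt I' I.tangent (fun y : M => (⟨f y, Y y⟩ : TangentBundle I N)) x) (l : ι) :
    MDifferentiableAt I' 𝓘(ℝ, ℝ) (fun y => b.repr (transportTo I (f x) (Y y)) l) x ∧
      ∀ W, mvfderiv I' (fun y => b.repr (transportTo I (f x) (Y y)) l) x W =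
        b.repr (componentDeriv f Y x W) l := by
  let φ : E →L[ℝ] ℝ := LinearMap.toContinuousLinearMap (b.coord l ∘ₗ
    ((trivializationAt E (fun q : N => TangentSpace I q) (f x)).symmL ℝ (f x)).toLinearMap)
  have h := (mdifferentiableAt_coord hY).hasMFDerivAt
  have h2 := (φ.hasMFDerivAt (x := (trivializationAt E (fun q : N => TangentSpace I q) (f x)
    ⟨f x, Y x⟩).2)).comp x h
  refine ⟨h2.mdifferentiableAt, fun W => ?_⟩
  exact congr($(h2.mfderiv) W)

theorem eventually_inner_eq_sum {ι : Type*} [Fintype ι]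
    (b : Module.Basis ι ℝ (TangentSpace I (f x))) (hf : ContinuousAt f x) :
    ∀ᶠ y in nhds x, inner ℝ (Y y) (Z y) =
      ∑ l, ∑ m, b.repr (transportTo I (f x) (Y y)) l * b.repr (transportTo I (f x) (Z y)) m *
        inner ℝ (coordField I (b l) (f y)) (coordField I (b m) (f y)) := by
  have := hf.eventually ((trivializationAt E (fun q : N => TangentSpace I q)
    (f x)).open_baseSet.mem_nhds (FiberBundle.mem_baseSet_trivializationAt' (f x)))
  filter_upwards [this] with y hy
  rw [← inner_sum_sum, ← coordField_sum, ← coordField_sum, b.sum_repr, b.sum_repr,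
    coordField_transportTo I hy, coordField_transportTo I hy]

/-- The covariant derivative along a map is compatible with the metric. -/
theorem mvfderiv_inner
    (hY : MDifferentiableAt I' I.tangent (fun y : M => (⟨f y, Y y⟩ : TangentBundle I N)) x)
    (hZ : MDifferentiableAt I' I.tangent (fun y : M => (⟨f y, Z y⟩ : TangentBundle I N)) x)
    (W : TangentSpace I' x) :
    mvfderiv I' (fun y => inner ℝ (Y y) (Z y)) x W =
      inner ℝ (covDerivAlong I I' f Y x W) (Z x) + inner ℝ (Y x) (covDerivAlong I I' f Z x W) := by
  have hf := mdifferentiableAt_base hY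
  let b := (stdOrthonormalBasis ℝ (TangentSpace I (f x))).toBasis
  have hg (l m) : MDifferentiableAt I' 𝓘(ℝ, ℝ)
      (fun y => inner ℝ (coordField I (b l) (f y)) (coordField I (b m) (f y))) x :=
    (mdiff_inner_coordField I (b l) (b m)).comp x hf
  have hg' (l m) : mvfderiv I'
      (fun y => inner ℝ (coordField I (b l) (f y)) (coordField I (b m) (f y))) x W =
        metricDeriv I (mfderiv I' I f x W) (b l) (b m) :=
    congr($(mfderiv_comp x (mdiff_inner_coordField I (b l) (b m)) hf) W)
  have hY' := mdifferentiableAt_repr_transportTo b hY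
  have hZ' := mdifferentiableAt_repr_transportTo b hZ
  have hterm (l m) : MDifferentiableAt I' 𝓘(ℝ, ℝ)
      (fun y => b.repr (transportTo I (f x) (Y y)) l * b.repr (transportTo I (f x) (Z y)) m *
        inner ℝ (coordField I (b l) (f y)) (coordField I (b m) (f y))) x :=
    ((hY' l).1.mul (hZ' m).1).mul (hg l m)
  have hterm' (l m) : mvfderiv I'
      (fun y => b.repr (transportTo I (f x) (Y y)) l * b.repr (transportTo I (f x) (Z y)) m *
        inner ℝ (coordField I (b l) (f y)) (coordField I (b m) (f y))) x W =
      b.repr (componentDeriv f Y x W) l * b.repr (Z x) m * inner ℝ (b l) (b m) +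
      b.repr (Y x) l * b.repr (componentDeriv f Z x W) m * inner ℝ (b l) (b m) +
      b.repr (Y x) l * b.repr (Z x) m * metricDeriv I (mfderiv I' I f x W) (b l) (b m) := by
    have h1 := congr($(mvfderiv_fun_mul ((hY' l).1.mul (hZ' m).1) (hg l m)) W)
    have h2 := congr($(mvfderiv_fun_mul (hY' l).1 (hZ' m).1) W)
    simp only [add_apply, smul_apply, smul_eq_mul,
      Pi.mul_apply, transportTo_self, coordField_self, (hY' l).2 W, (hZ' m).2 W, hg' l m] at h1 h2
    refine h1.trans ?_
    refine (congrArg (fun r => _ + _ * r) h2).trans ?_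
    ring
  rw [mvfderiv_congr_of_eventuallyEq I' (eventually_inner_eq_sum b hf.continuousAt) W,
    (mvfderiv_sum_apply I' Finset.univ (fun l _ => (mvfderiv_sum_apply I' Finset.univ
      (fun m _ => hterm l m) W).1) W).2]
  rw [Finset.sum_congr rfl fun l _ => (mvfderiv_sum_apply I' Finset.univ
      (fun m _ => hterm l m) W).2]
  simp only [hterm', Finset.sum_add_distrib]
  rw [← inner_sum_sum, ← inner_sum_sum, ← metricDeriv_sum_sum]
  simp only [b.sum_repr]
  rw [metricDeriv_eq, covDerivAlong_eq, covDerivAlong_eq, inner_add_left, inner_add_right]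
  ring

end CovariantDerivative

section Gauss

variable {E : Type*} [NormedAddCommGroup E] [NormedSpace ℝ E] [FiniteDimensional ℝ E]
  {H : Type*} [TopologicalSpace H] {I : ModelWithCorners ℝ E H}
  {N : Type*} [TopologicalSpace N] [ChartedSpace H N] [IsManifold I ∞ N]
  {E' : Type*} [NormedAddCommGroup E'] [NormedSpace ℝ E'] [FiniteDimensional ℝ E']
  {H' : Type*} [TopologicalSpace H'] {I' : ModelWithCorners ℝ E' H'}
  {M : Type*} [TopologicalSpace M] [ChartedSpace H' M] [IsManifold I' ∞ M]
  {E'' : Type*} [NormedAddCommGroup E''] [NormedSpace ℝ E'']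
  {H'' : Type*} [TopologicalSpace H''] {I'' : ModelWithCorners ℝ E'' H''}
  {P : Type*} [TopologicalSpace P] [ChartedSpace H'' P]

theorem two_le_infty : (2 : WithTop ℕ∞) ≤ ∞ := WithTop.coe_le_coe.2 (le_top : (2 : ℕ∞) ≤ ⊤)

theorem mdifferentiableAt_mfderiv_apply {f : M → N} {g : P → M} {X : ∀ z : P, TangentSpace I' (g z)}
    {z : P} (hf : ContMDiffAt I' I ∞ f (g z))
    (hX : MDifferentiableAt I'' I'.tangent (fun y : P => (⟨g y, X y⟩ : TangentBundle I' M)) z) :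
    MDifferentiableAt I'' I.tangent
      (fun y : P => (⟨f (g y), mfderiv I' I f (g y) (X y)⟩ : TangentBundle I N)) z := by
  have h1 := (ContMDiffAt.mfderiv_const hf (m := 1)
    (by rw [one_add_one_eq_two]; exact two_le_infty)).mdifferentiableAt
    one_ne_zero
  have hg := mdifferentiableAt_base hX
  have hfg := (hf.mdifferentiableAt (by simp)).comp z hg
  exact MDifferentiableAt.clm_apply_of_inCoordinates (h1.comp z hg) hX hfg

variable [RiemannianBundle (fun p : N => TangentSpace I p)]
  [IsContMDiffRiemannianBundle I ∞ E (fun p : N => TangentSpace I p)]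

theorem covDerivAlong_comp
    {f : M → N} {Y : ∀ y : M, TangentSpace I (f y)} {g : P → M} {z : P}
    (hY : MDifferentiableAt I' I.tangent (fun y : M => (⟨f y, Y y⟩ : TangentBundle I N)) (g z))
    (hg : MDifferentiableAt I'' I' g z) (W : TangentSpace I'' z) :
    covDerivAlong I I'' (f ∘ g) (fun y => Y (g y)) z W =
      covDerivAlong I I' f Y (g z) (mfderiv I'' I' g z W) := by
  have h1 := congr($(mfderiv_comp z (mdifferentiableAt_coord hY) hg) W)
  have h2 := congr($(mfderiv_comp z (mdifferentiableAt_base hY) hg) W)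
  rw [covDerivAlong_eq, covDerivAlong_eq, h2]
  refine congrArg (fun v => (trivializationAt E (fun q : N => TangentSpace I q) (f (g z))).symmL ℝ
    (f (g z)) v + _) ?_
  exact h1

theorem covDerivAlong_coordField
    {f : M → N} {x : M} (hf : ContinuousAt f x) (c : TangentSpace I (f x)) (W : TangentSpace I' x) :
    covDerivAlong I I' f (fun y => coordField I c (f y)) x W =
      christoffel I (mfderiv I' I f x W) c := by
  have he : (fun y : M => (trivializationAt E (fun q : N => TangentSpace I q) (f x)
      ⟨f y, coordField I c (f y)⟩).2) =ᶠ[nhds x]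
      fun _ => (trivializationAt E (fun q : N => TangentSpace I q) (f x) ⟨f x, c⟩).2 := by
    filter_upwards [hf.eventually ((trivializationAt E (fun q : N => TangentSpace I q)
      (f x)).open_baseSet.mem_nhds (FiberBundle.mem_baseSet_trivializationAt' (f x)))] with y hy
    rw [coordField, Trivialization.symmL_apply _ hy, Trivialization.apply_mk_symm _ hy]
  rw [covDerivAlong_eq, componentDeriv, mvfderiv_congr_of_eventuallyEq I' he, mvfderiv_const,
    coordField_self]
  simp

variable [RiemannianBundle (fun p : M => TangentSpace I' p)]
  [IsContMDiffRiemannianBundle I' ∞ E' (fun p : M => TangentSpace I' p)]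

theorem eventually_coord_mfderiv_coordField [I'.Boundaryless] {f : M → N} {x : M}
    (hf : ContMDiffAt I' I ∞ f x) (b : TangentSpace I' x) :
    (fun y : M => (trivializationAt E (fun q : N => TangentSpace I q) (f x)
      ⟨f y, mfderiv I' I f y (coordField I' b y)⟩).2) =ᶠ[nhds x]
    fun y => fderiv ℝ (writtenInExtChartAt I' I x f) (extChartAt I' x y)
      (trivializationAt E' (fun q : M => TangentSpace I' q) x ⟨x, b⟩).2 := by
  filter_upwards [hf.continuousAt.eventually ((chartAt H (f x)).open_source.mem_nhds
      (mem_chart_source H (f x))), (chartAt H' x).open_source.mem_nhds (mem_chart_source H' x),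
      (contMDiffAt_iff_contMDiffAt_nhds (n := 1) (by simp)).1 (hf.of_le (by simp))] with y hy hy' hfy
  have hfy' := hfy.mdifferentiableAt one_ne_zero
  have hsrc : y ∈ (extChartAt I' x).source := by simpa using hy'
  have hinv := (extChartAt I' x).left_inv hsrc
  have h1 : MDifferentiableAt 𝓘(ℝ, E') I' (extChartAt I' x).symm (extChartAt I' x y) := by
    have := mdifferentiableWithinAt_extChartAt_symm ((extChartAt I' x).map_source hsrc)
    rwa [I'.range_eq_univ, mdifferentiableWithinAt_univ] at this
  have h2 : MDifferentiableAt I 𝓘(ℝ, E) (extChartAt I (f x)) (f y) :=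
    mdifferentiableAt_extChartAt hy
  have e1 := TangentBundle.symmL_trivializationAt (I := I') hy'
  rw [I'.range_eq_univ, mfderivWithin_univ] at e1
  have e2 := TangentBundle.continuousLinearMapAt_trivializationAt (I := I) hy
  have h3 : HasMFDerivAt I' I f ((extChartAt I' x).symm (extChartAt I' x y))
      (mfderiv I' I f y : E' →L[ℝ] E) := by
    have (z : M) (hz : z = y) : HasMFDerivAt I' I f z (mfderiv I' I f y : E' →L[ℝ] E) := by
      subst hz; exact hfy'.hasMFDerivAt
    exact this _ hinv
  have h4 : HasMFDerivAt I 𝓘(ℝ, E) (extChartAt I (f x))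
      (f ((extChartAt I' x).symm (extChartAt I' x y)))
      (mfderiv I 𝓘(ℝ, E) (extChartAt I (f x)) (f y) : E →L[ℝ] E) := by
    have (z : N) (hz : z = f y) : HasMFDerivAt I 𝓘(ℝ, E) (extChartAt I (f x)) z
        (mfderiv I 𝓘(ℝ, E) (extChartAt I (f x)) (f y) : E →L[ℝ] E) := by
      subst hz; exact h2.hasMFDerivAt
    exact this _ (congrArg f hinv)
  have h5 := (HasMFDerivAt.comp (f := f ∘ (extChartAt I' x).symm) (extChartAt I' x y) h4
    (HasMFDerivAt.comp (extChartAt I' x y) h3 h1.hasMFDerivAt)).mfderiv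
  have e3 (v : TangentSpace I (f y)) : (trivializationAt E (fun q : N => TangentSpace I q) (f x)
      ⟨f y, v⟩).2 = (trivializationAt E (fun q : N => TangentSpace I q) (f x)).continuousLinearMapAt
        ℝ (f y) v :=
    ((trivializationAt E (fun q : N => TangentSpace I q) (f x)).coe_linearMapAt_of_mem (R := ℝ)
      hy ▸ rfl)
  rw [e3, e2, coordField, e1, ← mfderiv_eq_fderiv]
  exact congr($(h5.symm) _)

theorem covDerivAlong_mfderiv_coordField_comm [I'.Boundaryless] {f : M → N} {x : M}
    (hf : ContMDiffAt I' I ∞ f x) (a b : TangentSpace I' x) :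
    covDerivAlong I I' f (fun y => mfderiv I' I f y (coordField I' b y)) x a =
      covDerivAlong I I' f (fun y => mfderiv I' I f y (coordField I' a y)) x b := by
  have hF : ContDiffAt ℝ ∞ (writtenInExtChartAt I' I x f) (extChartAt I' x x) := by
    have := (contMDiffAt_iff.1 hf).2
    rwa [I'.range_eq_univ, contDiffWithinAt_univ] at this
  have hsymm : IsSymmSndFDerivAt ℝ (writtenInExtChartAt I' I x f) (extChartAt I' x x) :=
    hF.isSymmSndFDerivAt (by simpa using two_le_infty)
  have hF' : DifferentiableAt ℝ (fderiv ℝ (writtenInExtChartAt I' I x f)) (extChartAt I' x x) :=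
    (hF.fderiv_right (m := 1) (by rw [one_add_one_eq_two]; exact two_le_infty)).differentiableAt
      one_ne_zero
  have hcoord (v : TangentSpace I' x) :
      (trivializationAt E' (fun q : M => TangentSpace I' q) x ⟨x, v⟩).2 =
        mfderiv I' 𝓘(ℝ, E') (extChartAt I' x) x v := by
    have hx := mem_chart_source H' x
    rw [← TangentBundle.continuousLinearMapAt_trivializationAt hx]
    exact ((trivializationAt E' (fun q : M => TangentSpace I' q) x).coe_linearMapAt_of_mem (R := ℝ)
      hx ▸ rfl)
  have key (a b : TangentSpace I' x) :
      mvfderiv I' (fun y : M => (trivializationAt E (fun q : N => TangentSpace I q) (f x)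
        ⟨f y, mfderiv I' I f y (coordField I' b y)⟩).2) x a =
      fderiv ℝ (fderiv ℝ (writtenInExtChartAt I' I x f)) (extChartAt I' x x)
        (trivializationAt E' (fun q : M => TangentSpace I' q) x ⟨x, a⟩).2
        (trivializationAt E' (fun q : M => TangentSpace I' q) x ⟨x, b⟩).2 := by
    rw [mvfderiv_congr_of_eventuallyEq I' (eventually_coord_mfderiv_coordField hf b)]
    have h1 := (hF'.hasFDerivAt.clm_apply (hasFDerivAt_const
      (trivializationAt E' (fun q : M => TangentSpace I' q) x ⟨x, b⟩).2 _)).hasMFDerivAt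
    have h2 := (mdifferentiableAt_extChartAt (I := I') (mem_chart_source H' x)).hasMFDerivAt
    refine congr($((h1.comp x h2).mfderiv) a).trans ?_
    rw [hcoord a, ContinuousLinearMap.comp_zero, zero_add]
    rfl
  rw [covDerivAlong_eq, covDerivAlong_eq, componentDeriv, componentDeriv, key, key, hsymm.eq,
    coordField_self, coordField_self, christoffel_comm]

/-- Christoffel symbols of the induced metric. -/
theorem christoffelFirst_eq_inner_covDerivAlong [I'.Boundaryless] {f : M → N}
    (hf : IsRiemannianSubmanifold I I' f) {x : M} (a b c : TangentSpace I' x) :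
    christoffelFirst I' a b c =
      inner ℝ (covDerivAlong I I' f (fun y => mfderiv I' I f y (coordField I' b y)) x a)
        (mfderiv I' I f x c) := by
  have hm (b : TangentSpace I' x) : MDifferentiableAt I' I.tangent
      (fun y : M => (⟨f y, mfderiv I' I f y (coordField I' b y)⟩ : TangentBundle I N)) x :=
    mdifferentiableAt_mfderiv_apply (g := id) hf.contMDiff.contMDiffAt (mdiff_coordField I' b)
  have hd (a b c : TangentSpace I' x) : metricDeriv I' a b c =
      inner ℝ (covDerivAlong I I' f (fun y => mfderiv I' I f y (coordField I' b y)) x a)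
        (mfderiv I' I f x c) +
      inner ℝ (covDerivAlong I I' f (fun y => mfderiv I' I f y (coordField I' c y)) x a)
        (mfderiv I' I f x b) := by
    have h := mvfderiv_inner (hm b) (hm c) a
    simp only [coordField_self, hf.isometric] at h
    rw [metricDeriv, h, real_inner_comm _ (mfderiv I' I f x b)]
  have hs := covDerivAlong_mfderiv_coordField_comm (hf.contMDiff.contMDiffAt (x := x))
  rw [christoffelFirst, hd, hd, hd, hs b a, hs c a, hs c b]
  ring

theorem mdifferentiableAt_velocity {γ : ℝ → M} {t : ℝ} (hγ : ContMDiffAt 𝓘(ℝ, ℝ) I' ∞ γ t) :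
    MDifferentiableAt 𝓘(ℝ, ℝ) I'.tangent
      (fun s => (⟨γ s, velocity I' γ s⟩ : TangentBundle I' M)) t := by
  refine mdifferentiableAt_mfderiv_apply (g := id) (X := fun _ => (1 : ℝ)) hγ ?_
  refine (mdifferentiableAt_totalSpace _ _).2 ⟨mdifferentiableAt_id, ?_⟩
  simp only [trivializationAt_model_space_apply]
  exact mdifferentiableAt_const

theorem eventually_velocity_comp {f : M → N} {γ : ℝ → M} {t : ℝ} (hf : ContMDiff I' I ∞ f)
    (hγ : ContMDiffAt 𝓘(ℝ, ℝ) I' ∞ γ t) :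
    ∀ᶠ s in nhds t, velocity I (f ∘ γ) s = mfderiv I' I f (γ s) (velocity I' γ s) := by
  filter_upwards [(contMDiffAt_iff_contMDiffAt_nhds (n := 1) (by simp)).1
    (hγ.of_le (by simp))] with s hs
  exact congr($(mfderiv_comp s ((hf (γ s)).mdifferentiableAt (by simp))
    (hs.mdifferentiableAt one_ne_zero)) (1 : ℝ))

/-- The component of the acceleration in the ambient manifold that is tangent to the submanifold
is the acceleration in the submanifold. -/
theorem inner_acceleration_comp [I'.Boundaryless] {f : M → N}
    (hf : IsRiemannianSubmanifold I I' f) {γ : ℝ → M} {t : ℝ}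
    (hγ : ContMDiffAt 𝓘(ℝ, ℝ) I' ∞ γ t) (w : TangentSpace I' (γ t)) :
    inner ℝ (acceleration I (f ∘ γ) t) (mfderiv I' I f (γ t) w) =
      inner ℝ (acceleration I' γ t) w := by
  have hγ' : MDifferentiableAt 𝓘(ℝ, ℝ) I' γ t := hγ.mdifferentiableAt (by simp)
  have hv := mdifferentiableAt_velocity hγ
  have hw : MDifferentiableAt 𝓘(ℝ, ℝ) I'.tangent
      (fun s => (⟨γ s, coordField I' w (γ s)⟩ : TangentBundle I' M)) t :=
    (mdiff_coordField I' w).comp t hγ'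
  have hfv := mdifferentiableAt_velocity ((hf.contMDiff (γ t)).comp t hγ)
  have hfw := mdifferentiableAt_mfderiv_apply (hf.contMDiff (γ t)) hw
  have h1 := mvfderiv_inner hv hw (1 : ℝ)
  have h2 := mvfderiv_inner (f := f ∘ γ) (Y := velocity I (f ∘ γ))
    (Z := fun s => mfderiv I' I f (γ s) (coordField I' w (γ s))) hfv hfw (1 : ℝ)
  have hvel := eventually_velocity_comp hf.contMDiff hγ
  have he : (fun s => (inner ℝ (velocity I (f ∘ γ) s)
      (mfderiv I' I f (γ s) (coordField I' w (γ s))) : ℝ)) =ᶠ[nhds t]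
      fun s => inner ℝ (velocity I' γ s) (coordField I' w (γ s)) := by
    filter_upwards [hvel] with s hs
    rw [hs]
    exact hf.isometric _ _ _
  have h3 := covDerivAlong_comp (I'' := 𝓘(ℝ, ℝ)) (f := f) (g := γ)
    (Y := fun y => mfderiv I' I f y (coordField I' w y)) (z := t)
    (mdifferentiableAt_mfderiv_apply (g := id) (hf.contMDiff _) (mdiff_coordField I' w)) hγ' (1 : ℝ)
  have h4 := covDerivAlong_coordField (I' := 𝓘(ℝ, ℝ)) hγ'.continuousAt w (1 : ℝ)
  have h5 := christoffelFirst_eq_inner_covDerivAlong hf (velocity I' γ t) w (velocity I' γ t)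
  have h6 := inner_christoffel I' (velocity I' γ t) w (velocity I' γ t)
  replace h2 := (mvfderiv_congr_of_eventuallyEq 𝓘(ℝ, ℝ) he (1 : ℝ)).symm.trans h2
  rw [h1, h3, hvel.self_of_nhds, h4] at h2
  simp only [coordField_self] at h2
  have h7 : inner ℝ (velocity I' γ t) (christoffel I' (mfderiv 𝓘(ℝ, ℝ) I' γ t (1 : ℝ)) w) =
      inner ℝ (mfderiv I' I f (γ t) (velocity I' γ t))
        (covDerivAlong I I' f (fun y => mfderiv I' I f y (coordField I' w y)) (γ t)
          (mfderiv 𝓘(ℝ, ℝ) I' γ t (1 : ℝ))) := by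
    rw [real_inner_comm, real_inner_comm _ (mfderiv I' I f (γ t) (velocity I' γ t))]
    exact h6.trans h5
  rw [h7] at h2
  exact (add_right_cancel h2).symm

/-- A parallel field orthogonal to a curve is orthogonal to the acceleration of the curve. -/
theorem inner_acceleration_eq_zero_of_isParallelAlong {f : M → N}
    {Y : ∀ y : M, TangentSpace I (f y)} (hY : IsParallelAlong I I' f Y) (hf : ContMDiff I' I ∞ f)
    {γ : ℝ → M} {t : ℝ} (hγ : ContMDiffAt 𝓘(ℝ, ℝ) I' ∞ γ t)
    (horth : ∀ᶠ s in nhds t, inner ℝ (Y (γ s)) (velocity I (f ∘ γ) s) = 0) :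
    inner ℝ (Y (γ t)) (acceleration I (f ∘ γ) t) = 0 := by
  have hγ' : MDifferentiableAt 𝓘(ℝ, ℝ) I' γ t := hγ.mdifferentiableAt (by simp)
  have hYm : MDifferentiableAt I' I.tangent
      (fun y : M => (⟨f y, Y y⟩ : TangentBundle I N)) (γ t) :=
    (hY.contMDiff _).mdifferentiableAt (by simp)
  have h1 := mvfderiv_inner (f := f ∘ γ) (Y := fun s => Y (γ s)) (Z := velocity I (f ∘ γ))
    (hYm.comp t hγ') (mdifferentiableAt_velocity ((hf (γ t)).comp t hγ)) (1 : ℝ)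
  replace h1 := (mvfderiv_congr_of_eventuallyEq 𝓘(ℝ, ℝ) horth (1 : ℝ)).symm.trans h1
  rw [covDerivAlong_comp hYm hγ' (1 : ℝ),
    hY.covDerivAlong_eq_zero, mvfderiv_const, inner_zero_left, zero_add] at h1
  exact h1.symm

end Gauss

end

section Hyperplane

variable {V : Type*} [NormedAddCommGroup V] [InnerProductSpace ℝ V] [FiniteDimensional ℝ V]

theorem finrank_orthogonal_eq_one {K : Submodule ℝ V}
    (hK : Module.finrank ℝ K + 1 = Module.finrank ℝ V) : Module.finrank ℝ Kᗮ = 1 := by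
  have := K.finrank_add_finrank_orthogonal
  omega

theorem eq_zero_of_mem_orthogonal {K : Submodule ℝ V}
    (hK : Module.finrank ℝ K + 1 = Module.finrank ℝ V) {a b : V} (ha : a ∈ Kᗮ) (hb : b ∈ Kᗮ)
    (hb0 : b ≠ 0) (hab : inner ℝ a b = 0) : a = 0 := by
  obtain ⟨c, hc⟩ := (finrank_eq_one_iff_of_nonzero' (⟨b, hb⟩ : Kᗮ) (by simpa using hb0)).1
    (finrank_orthogonal_eq_one hK) ⟨a, ha⟩
  have hc' : c • b = a := congrArg Subtype.val hc
  rw [← hc', real_inner_smul_left] at hab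
  rcases mul_eq_zero.1 hab with h | h
  · rw [← hc', h, zero_smul]
  · exact absurd (inner_self_eq_zero.1 h) hb0

theorem mem_of_inner_eq_zero {K : Submodule ℝ V}
    (hK : Module.finrank ℝ V ≤ Module.finrank ℝ K + 1) {a y : V} (ha : a ∈ Kᗮ) (ha0 : a ≠ 0)
    (hya : inner ℝ y a = 0) : y ∈ K := by
  rw [← K.orthogonal_orthogonal, Submodule.mem_orthogonal']
  intro v hv
  have h1 : Module.finrank ℝ Kᗮ = 1 := by
    have h := K.finrank_add_finrank_orthogonal
    have : Module.finrank ℝ Kᗮ ≠ 0 := fun h0 => ha0 (by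
      rw [Submodule.finrank_eq_zero.1 h0] at ha
      exact (Submodule.mem_bot ℝ).1 ha)
    omega
  obtain ⟨c, hc⟩ := (finrank_eq_one_iff_of_nonzero' (⟨a, ha⟩ : Kᗮ) (by simpa using ha0)).1 h1 ⟨v, hv⟩
  have hc' : c • a = v := congrArg Subtype.val hc
  rw [← hc', real_inner_smul_right, hya, mul_zero]

end Hyperplane

theorem IsRiemannianSubmanifold.mfderiv_injective {E : Type*} [NormedAddCommGroup E]
    [NormedSpace ℝ E] [FiniteDimensional ℝ E]
    {H : Type*} [TopologicalSpace H] {I : ModelWithCorners ℝ E H}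
    {N : Type*} [TopologicalSpace N] [ChartedSpace H N] [IsManifold I ∞ N]
    [RiemannianBundle (fun p : N => TangentSpace I p)]
    {E' : Type*} [NormedAddCommGroup E'] [NormedSpace ℝ E'] [FiniteDimensional ℝ E']
    {H' : Type*} [TopologicalSpace H'] {I' : ModelWithCorners ℝ E' H'}
    {M : Type*} [TopologicalSpace M] [ChartedSpace H' M] [IsManifold I' ∞ M]
    [RiemannianBundle (fun p : M => TangentSpace I' p)] {f : M → N}
    (hf : IsRiemannianSubmanifold I I' f) (x : M) : Function.Injective (mfderiv I' I f x) := by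
  refine (injective_iff_map_eq_zero (mfderiv I' I f x)).2 fun v hv => ?_
  have := hf.isometric x v v
  rw [hv, inner_zero_left] at this
  exact inner_self_eq_zero.1 this.symm

theorem mainTheorem3 (n k : ℕ) (hn : 2 ≤ n)
    -- the Riemannian manifold `N` of dimension `n + k`
    {N : Type*} [TopologicalSpace N] [T2Space N] [SecondCountableTopology N]
    [ChartedSpace (EuclideanSpace ℝ (Fin (n + k))) N] [IsManifold (𝓡 (n + k)) ∞ N]
    [RiemannianBundle (fun p : N => TangentSpace (𝓡 (n + k)) p)]
    [IsContMDiffRiemannianBundle (𝓡 (n + k)) ∞ (EuclideanSpace ℝ (Fin (n + k)))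
      (fun p : N => TangentSpace (𝓡 (n + k)) p)]
    -- the submanifold `M` of dimension `n`
    {M : Type*} [TopologicalSpace M] [T2Space M] [SecondCountableTopology M]
    [ChartedSpace (EuclideanSpace ℝ (Fin n)) M] [IsManifold (𝓡 n) ∞ M]
    [RiemannianBundle (fun p : M => TangentSpace (𝓡 n) p)]
    [IsContMDiffRiemannianBundle (𝓡 n) ∞ (EuclideanSpace ℝ (Fin n))
      (fun p : M => TangentSpace (𝓡 n) p)]
    (i : M → N) (hi : IsRiemannianSubmanifold (𝓡 (n + k)) (𝓡 n) i)
    -- the hypersurface `L` of `M`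
    {L : Type*} [TopologicalSpace L] [T2Space L] [SecondCountableTopology L]
    [ChartedSpace (EuclideanSpace ℝ (Fin (n - 1))) L] [IsManifold (𝓡 (n - 1)) ∞ L]
    [RiemannianBundle (fun p : L => TangentSpace (𝓡 (n - 1)) p)]
    [IsContMDiffRiemannianBundle (𝓡 (n - 1)) ∞ (EuclideanSpace ℝ (Fin (n - 1)))
      (fun p : L => TangentSpace (𝓡 (n - 1)) p)]
    (j : L → M) (hj : IsRiemannianSubmanifold (𝓡 n) (𝓡 (n - 1)) j)
    -- `L` is not totally geodesic in `N` at any point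
    (hL : ∀ x : L, ¬ IsTotallyGeodesicAt (𝓡 (n + k)) (𝓡 (n - 1)) (i ∘ j) x)
    -- `Y` is parallel along `M` and orthogonal to `L`
    (Y : ∀ y : M, TangentSpace (𝓡 (n + k)) (i y))
    (hY : IsParallelAlong (𝓡 (n + k)) (𝓡 n) i Y)
    (hYL : ∀ (x : L) (v : TangentSpace (𝓡 (n - 1)) x),
      inner ℝ (Y (j x)) (mfderiv (𝓡 n) (𝓡 (n + k)) i (j x)
        (mfderiv (𝓡 (n - 1)) (𝓡 n) j x v)) = 0) :
    ((∀ x : L, Y (j x) ≠ 0) →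
      Set.range j ⊆ shadowBoundary (𝓡 (n + k)) (𝓡 n) i Y →
      IsTotallyGeodesic (𝓡 n) (𝓡 (n - 1)) j) ∧
    (k ≤ 1 → IsTotallyGeodesic (𝓡 n) (𝓡 (n - 1)) j →
      Set.range j ⊆ shadowBoundary (𝓡 (n + k)) (𝓡 n) i Y) := by
  have hN (p : N) : Module.finrank ℝ (TangentSpace (𝓡 (n + k)) p) = n + k :=
    finrank_euclideanSpace_fin
  have hM (p : M) : Module.finrank ℝ (TangentSpace (𝓡 n) p) = n := finrank_euclideanSpace_fin
  have hLd (p : L) : Module.finrank ℝ (TangentSpace (𝓡 (n - 1)) p) = n - 1 :=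
    finrank_euclideanSpace_fin
  have hacc {γ : ℝ → L} {s : Set ℝ} (hγ : IsGeodesicOn (𝓡 (n - 1)) γ s) {t : ℝ} (ht : t ∈ s) :
      inner ℝ (Y (j (γ t))) (acceleration (𝓡 (n + k)) (i ∘ j ∘ γ) t) = 0 := by
    have hs := hγ.isOpen.mem_nhds ht
    have hγt := hγ.contMDiffOn.contMDiffAt hs
    have hjγ := (hj.contMDiff (γ t)).comp t hγt
    refine inner_acceleration_eq_zero_of_isParallelAlong (γ := j ∘ γ) hY hi.contMDiff hjγ ?_
    filter_upwards [(eventually_velocity_comp hi.contMDiff hjγ),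
      eventually_velocity_comp hj.contMDiff hγt] with r h1 h2
    rw [h1, h2]
    exact hYL _ _
  refine ⟨fun hY0 hsub γ s hγ => ⟨hγ.isOpen, hγ.ordConnected,
    hj.contMDiff.comp_contMDiffOn hγ.contMDiffOn, fun t ht => ?_⟩, fun hk htg => ?_⟩
  · have hγt := hγ.contMDiffOn.contMDiffAt (hγ.isOpen.mem_nhds ht)
    have hjγ := (hj.contMDiff (γ t)).comp t hγt
    obtain ⟨w, hw⟩ := hsub ⟨γ t, rfl⟩
    have hw0 : w ≠ 0 := fun h => hY0 (γ t) (by rw [← hw, h, map_zero])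
    let K : Submodule ℝ (TangentSpace (𝓡 n) (j (γ t))) :=
      LinearMap.range (mfderiv (𝓡 (n - 1)) (𝓡 n) j (γ t)).toLinearMap
    have hK : Module.finrank ℝ K + 1 = Module.finrank ℝ (TangentSpace (𝓡 n) (j (γ t))) := by
      rw [LinearMap.finrank_range_of_inj (hj.mfderiv_injective (γ t)), hM, hLd]
      omega
    refine eq_zero_of_mem_orthogonal (a := acceleration (𝓡 n) (j ∘ γ) t) (b := w) hK ?_ ?_ hw0 ?_
    · rw [Submodule.mem_orthogonal']
      rintro _ ⟨v, rfl⟩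
      refine (inner_acceleration_comp hj hγt v).trans ?_
      rw [hγ.acceleration_eq_zero t ht, inner_zero_left]
    · rw [Submodule.mem_orthogonal']
      rintro _ ⟨v, rfl⟩
      refine (hi.isometric (j (γ t)) w _).symm.trans ?_
      rw [hw]
      exact hYL (γ t) v
    · refine (inner_acceleration_comp hi hjγ w).symm.trans ?_
      refine (real_inner_comm _ _).trans ?_
      refine Eq.trans ?_ (hacc hγ ht)
      exact congrArg (fun v => inner ℝ v (acceleration (𝓡 (n + k)) (i ∘ j ∘ γ) t)) hw
  · rintro _ ⟨x, rfl⟩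
    have h := hL x
    simp only [IsTotallyGeodesicAt, not_forall] at h
    obtain ⟨γ, s, hγ, t, ht, rfl, hne⟩ := h
    have hγt := hγ.contMDiffOn.contMDiffAt (hγ.isOpen.mem_nhds ht)
    have hjγ := (hj.contMDiff (γ t)).comp t hγt
    let K : Submodule ℝ (TangentSpace (𝓡 (n + k)) (i (j (γ t)))) :=
      LinearMap.range (mfderiv (𝓡 n) (𝓡 (n + k)) i (j (γ t))).toLinearMap
    have hK : Module.finrank ℝ (TangentSpace (𝓡 (n + k)) (i (j (γ t)))) ≤
        Module.finrank ℝ K + 1 := by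
      rw [LinearMap.finrank_range_of_inj (hi.mfderiv_injective (j (γ t))), hM, hN]
      omega
    refine mem_of_inner_eq_zero (K := K) (a := acceleration (𝓡 (n + k)) (i ∘ j ∘ γ) t)
      (y := Y (j (γ t))) hK ?_ hne (hacc hγ ht)
    rw [Submodule.mem_orthogonal']
    rintro _ ⟨v, rfl⟩
    refine (inner_acceleration_comp hi hjγ v).trans ?_
    rw [(htg γ s hγ).acceleration_eq_zero t ht, inner_zero_left]
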